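/- For real angles $\theta,\gamma,\phi$ put $N(\theta,\gamma)=\sqrt{\cos^2\gamma+\sin^2\gamma\cos^2\theta}$ and define vectors of $\mathbb{C}^3$ (with standard basis $|0\rangle,|1\rangle,|2\rangle$) $$u(\theta)=\cos\theta\,|0\rangle+\sin\theta\,|2\rangle,\qquad v(\theta,\gamma,\phi)=\sin\gamma\sin\theta\,|0\rangle+\cos\gamma\,e^{i\phi}|1\rangle-\sin\gamma\cos\theta\,|2\rangle,$$ $$w(\theta,\gamma,\phi)=\tfrac{1}{N(\theta,\gamma)}\left(\sin\gamma\cos\theta\,e^{i\phi}|1\rangle+\cos\gamma\,|2\rangle\right).$$ Given six real angles $\theta_A,\gamma_A,\phi_A,\theta_B,\gamma_B,\phi_B$, let $$(|\alpha_0\rangle,\dots,|\alpha_4\rangle)=\big(|0\rangle,\ |1\rangle,\ u(\theta_A),\ v(\theta_A,\gamma_A,\phi_A),\ w(\theta_A,\gamma_A,\phi_A)\big),$$ $$(|\beta_0\rangle,\dots,|\beta_4\rangle)=\big(|1\rangle,\ v(\theta_B,\gamma_B,\phi_B),\ |0\rangle,\ u(\theta_B),\ w(\theta_B,\gamma_B,\phi_B)\big).$$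 Let $U,V$ be unitary $3\times3$ matrices and let $|\psi_i\rangle=U|\alpha_i\rangle\otimes V|\beta_i\rangle\in\mathbb{C}^3\otimes\mathbb{C}^3$, $i=0,\dots,4$. Suppose that $(|\psi_i\rangle)_{i=0}^4$ is an unextendible product basis, i.e. an orthonormal family of product vectors spanning a proper subspace whose orthogonal complement contains no nonzero product vector (for this family, this is equivalent to none of $\cos\theta_{A},\sin\theta_{A},\cos\gamma_{A},\sin\gamma_{A},\cos\theta_{B},\sin\theta_{B},\cos\gamma_{B},\sin\gamma_{B}$ being zero). Then the states $|\psi_0\rangle,\dots,|\psi_4\rangle$ cannot be perfectly discriminated by asymptotic LOCC: there is no measurement $M=(M_0,\dots,M_4)$ on $\mathbb{C}^3\otimes\mathbb{C}^3$ with $\langle\psi_i|M_i|\psi_i\rangle=1$ for all $i$ that lies in the topological closure of the set of measurements implementable by LOCC protocols with finitely many rounds of communication. (In each round of such a protocol one party performs a measurement, with finitely or countably many outcomes, on its own register and announces the outcome; later steps may depend on all earlier outcomes.) -/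

import Mathlib

open scoped Kronecker Matrix

noncomputable section

/-- A countable family of Kraus operators `K k : ℂ^d → ℂ^(e k)` describes a (complete) quantum
measurement if `∑ₖ (K k)ᴴ (K k) = 1`. Measurements with finitely many outcomes are those with
`K k = 0` for all large `k`. -/
def IsMeasurement {d : ℕ} {e : ℕ → ℕ} (K : ∀ k, Matrix (Fin (e k)) (Fin d) ℂ) : Prop :=
  HasSum (fun k => (K k)ᴴ * K k) (1 : Matrix (Fin d) (Fin d) ℂ)

/-- Bipartite LOCC protocols on `ℂ^dA ⊗ ℂ^dB` with at most `r` rounds of communication, whose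
final output is a label in `ι`. In each round one of the parties measures her/his own register
(whose dimension may change, e.g. by adding or discarding an ancilla) and broadcasts the outcome
`k`; the rest of the protocol may depend on `k`. At the end a label is announced. Local channels,
local and shared randomness and coarse-graining of outcomes are special cases. -/
inductive LOCCProtocol (ι : Type) : ℕ → ℕ → ℕ → Type
  | announce {r dA dB : ℕ} (i : ι) : LOCCProtocol ι r dA dB
  | alice {r dA dB : ℕ} (e : ℕ → ℕ) (K : ∀ k, Matrix (Fin (e k)) (Fin dA) ℂ)
      (hK : IsMeasurement K) (next : ∀ k, LOCCProtocol ι r (e k) dB) :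
      LOCCProtocol ι (r + 1) dA dB
  | bob {r dA dB : ℕ} (e : ℕ → ℕ) (K : ∀ k, Matrix (Fin (e k)) (Fin dB) ℂ)
      (hK : IsMeasurement K) (next : ∀ k, LOCCProtocol ι r dA (e k)) :
      LOCCProtocol ι (r + 1) dA dB

/-- The measurement (POVM) implemented by a protocol: on input state `ρ` the label `i` is announced
with probability `tr (P.povm i * ρ)`. The series converge because the operators of the
sub-protocols lie between `0` and `1` and `∑ₖ (K k)ᴴ (K k) = 1`. -/
def LOCCProtocol.povm {ι : Type} [DecidableEq ι] : {r dA dB : ℕ} → LOCCProtocol ι r dA dB →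
    ι → Matrix (Fin dA × Fin dB) (Fin dA × Fin dB) ℂ
  | _, _, _, .announce i => Pi.single i 1
  | _, _, dB, .alice _ K _ next => fun i => ∑' k,
      (K k ⊗ₖ (1 : Matrix (Fin dB) (Fin dB) ℂ))ᴴ * (next k).povm i *
        (K k ⊗ₖ (1 : Matrix (Fin dB) (Fin dB) ℂ))
  | _, dA, _, .bob _ K _ next => fun i => ∑' k,
      ((1 : Matrix (Fin dA) (Fin dA) ℂ) ⊗ₖ K k)ᴴ * (next k).povm i *
        ((1 : Matrix (Fin dA) (Fin dA) ℂ) ⊗ₖ K k)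

/-- The measurements that can be implemented exactly by a finite LOCC protocol. -/
def finiteLOCC (ι : Type) [DecidableEq ι] (dA dB : ℕ) :
    Set (ι → Matrix (Fin dA × Fin dB) (Fin dA × Fin dB) ℂ) :=
  {M | ∃ (r : ℕ) (P : LOCCProtocol ι r dA dB), P.povm = M}

/-- The measurements that can be implemented by asymptotic LOCC, i.e. with vanishing error by a
sequence of finite LOCC protocols: the topological closure of finite LOCC. -/
def asymptoticLOCC (ι : Type) [DecidableEq ι] (dA dB : ℕ) :
    Set (ι → Matrix (Fin dA × Fin dB) (Fin dA × Fin dB) ℂ) :=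
  closure (finiteLOCC ι dA dB)

/-- The measurement `M` identifies each state of the family `ρ` with certainty. -/
def PerfectlyDiscriminates {ι H : Type} [Fintype H] (M ρ : ι → Matrix H H ℂ) : Prop :=
  ∀ i, (M i * ρ i).trace = 1

/-- The states `ρ i` can be (perfectly) discriminated by asymptotic LOCC. -/
def DiscriminableByAsymptoticLOCC {ι : Type} [DecidableEq ι] {dA dB : ℕ}
    (ρ : ι → Matrix (Fin dA × Fin dB) (Fin dA × Fin dB) ℂ) : Prop :=
  ∃ M ∈ asymptoticLOCC ι dA dB, PerfectlyDiscriminates M ρ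

/-- The density matrix `|ψ⟩⟨ψ|` of a ket. -/
def pureState {H : Type} (ψ : H → ℂ) : Matrix H H ℂ :=
  Matrix.vecMulVec ψ (star ψ)

/-- The product ket `|a⟩ ⊗ |b⟩`. -/
def productKet {dA dB : ℕ} (a : Fin dA → ℂ) (b : Fin dB → ℂ) : Fin dA × Fin dB → ℂ :=
  fun p => a p.1 * b p.2

/-- Unextendible product bases: orthonormal families of product vectors that span a proper
subspace whose orthogonal complement contains no nonzero product vector. -/
structure IsUPB {ι : Type} [DecidableEq ι] {dA dB : ℕ} (ψ : ι → Fin dA × Fin dB → ℂ) : Prop where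
  product : ∀ i, ∃ a b, ψ i = productKet a b
  orthonormal : ∀ i j, star (ψ i) ⬝ᵥ ψ j = if i = j then 1 else 0
  proper : Submodule.span ℂ (Set.range ψ) ≠ ⊤
  unextendible : ∀ a b, (∀ i, star (ψ i) ⬝ᵥ productKet a b = 0) → productKet a b = 0

/-- The normalization `N = √(cos² γ + sin² γ cos² θ)`. -/
def upbNorm (θ γ : ℝ) : ℝ :=
  √(Real.cos γ ^ 2 + Real.sin γ ^ 2 * Real.cos θ ^ 2)

/-- `cos θ |0⟩ + sin θ |2⟩` -/
def upbKetTheta (θ : ℝ) : Fin 3 → ℂ :=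
  ![(Real.cos θ : ℂ), 0, (Real.sin θ : ℂ)]

/-- `sin γ sin θ |0⟩ + cos γ e^{iφ} |1⟩ - sin γ cos θ |2⟩` -/
def upbKetGamma (θ γ φ : ℝ) : Fin 3 → ℂ :=
  ![(Real.sin γ : ℂ) * (Real.sin θ : ℂ),
    (Real.cos γ : ℂ) * Complex.exp (Complex.I * (φ : ℂ)),
    -((Real.sin γ : ℂ) * (Real.cos θ : ℂ))]

/-- `(sin γ cos θ e^{iφ} |1⟩ + cos γ |2⟩) / N` -/
def upbKetLast (θ γ φ : ℝ) : Fin 3 → ℂ :=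
  (1 / (upbNorm θ γ : ℂ)) •
    ![0, (Real.sin γ : ℂ) * (Real.cos θ : ℂ) * Complex.exp (Complex.I * (φ : ℂ)),
      (Real.cos γ : ℂ)]

/-- Alice's five local states `|α₀⟩, …, |α₄⟩`. -/
def aliceKet (θ γ φ : ℝ) : Fin 5 → Fin 3 → ℂ :=
  ![![1, 0, 0], ![0, 1, 0], upbKetTheta θ, upbKetGamma θ γ φ, upbKetLast θ γ φ]

/-- Bob's five local states `|β₀⟩, …, |β₄⟩`. -/
def bobKet (θ γ φ : ℝ) : Fin 5 → Fin 3 → ℂ :=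
  ![![0, 1, 0], upbKetGamma θ γ φ, ![1, 0, 0], upbKetTheta θ, upbKetLast θ γ φ]

end

/-! Along a branch of a protocol the accumulated Kraus operator is `KA ⊗ₖ KB`, so the branch weighs
the kets by a product operator `A ⊗ₖ B` with `A = KAᴴ * KA` and `B = KBᴴ * KB`.

Rigidity: near the identity, normalized to trace one on each side, no other such product operator
keeps the five kets orthogonal. For labels at cyclic distance one Alice's kets are orthogonal and
Bob's are not; at distance two the roles are exchanged. Close to the identity the nonorthogonal
factor stays nonzero, so each condition falls on one party alone, and the conditions around one
pentagon force a scalar operator (`eq_smul_one_of_pentagon`).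

Trapping: by rigidity and compactness, an operator on the boundary of a small neighborhood costs
error at least `δ * tr A * tr B` (`exists_error_ge`). Stopping inside costs a similar amount,
because every label is wrong for some ket of substantial weight (`offdiag_sum_ge`). A round may jump
across the boundary, but mixing the parent with an outside child gives an operator on the boundary
(`error_ge_of_hasSum`): if the parent were good, the child would have to be bad, and if all children
are bad so is the parent. Induction on the protocol (`LOCCProtocol.error_ge`) yields a positive
error bound independent of the number of rounds. It is a closed condition, so it survives the
closure. -/

/-! ### Positive semidefinite matrices and countable sums of them. -/

section MatrixFacts
open scoped ComplexOrder MatrixOrder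

theorem Matrix.PosSemidef.norm_sq_form_le {n : Type*} [Fintype n] {M : Matrix n n ℂ}
    (hM : M.PosSemidef) (x y : n → ℂ) :
    ‖star x ⬝ᵥ M *ᵥ y‖ ^ 2 ≤ (star x ⬝ᵥ M *ᵥ x).re * (star y ⬝ᵥ M *ᵥ y).re := by
  classical
  obtain ⟨B, hB⟩ := CStarAlgebra.nonneg_iff_eq_star_mul_self.mp hM.nonneg
  have key : ∀ x y : n → ℂ, star x ⬝ᵥ M *ᵥ y =
      inner ℂ (WithLp.toLp 2 (B *ᵥ x)) (WithLp.toLp 2 (B *ᵥ y)) := fun x y => by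
    rw [EuclideanSpace.inner_eq_star_dotProduct, dotProduct_comm _ (star _), hB,
      Matrix.star_eq_conjTranspose, ← Matrix.mulVec_mulVec, Matrix.dotProduct_mulVec,
      ← Matrix.star_mulVec]
  have h := inner_mul_inner_self_le (𝕜 := ℂ) (WithLp.toLp 2 (B *ᵥ x)) (WithLp.toLp 2 (B *ᵥ y))
  rw [norm_inner_symm (WithLp.toLp 2 (B *ᵥ y)), ← sq] at h
  rw [key, key, key]
  exact h

theorem Matrix.PosSemidef.norm_apply_le_trace {n : Type*} [Fintype n] {M : Matrix n n ℂ}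
    (hM : M.PosSemidef) (a b : n) : ‖M a b‖ ≤ M.trace.re := by
  classical
  have h := hM.norm_sq_form_le (Pi.single a 1) (Pi.single b 1)
  have hle : ∀ c, (M c c).re ≤ M.trace.re := fun c => by
    rw [Matrix.trace, Complex.re_sum]
    exact Finset.single_le_sum (f := fun i => (M.diag i).re)
      (fun i _ => (Complex.le_def.1 (hM.diag_nonneg (i := i))).1) (Finset.mem_univ c)
  have hnn : ∀ c, 0 ≤ (M c c).re := fun c => (Complex.le_def.1 (hM.diag_nonneg (i := c))).1
  simp at h
  refine abs_le_of_sq_le_sq' (h.trans ?_) ((hnn a).trans (hle a)) |>.2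
  rw [sq]
  exact mul_le_mul (hle a) (hle b) (hnn b) ((hnn a).trans (hle a))

/-- Entries of a positive semidefinite matrix are bounded by its trace, and the trace is monotone;
comparison with the traces of `Y` therefore gives entrywise summability. -/
theorem summable_of_posSemidef_sub {n : Type*} [Fintype n] {X Y : ℕ → Matrix n n ℂ}
    (hX : ∀ k, (X k).PosSemidef) (hXY : ∀ k, (Y k - X k).PosSemidef) (hY : Summable Y) :
    Summable X := by
  have htr : Summable fun k => (Y k).trace.re :=
    (hY.map (Complex.reCLM.toLinearMap.toAddMonoidHom.comp (Matrix.traceAddMonoidHom n ℂ))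
      (Complex.continuous_re.comp continuous_id.matrix_trace))
  refine Pi.summable.2 fun a => Pi.summable.2 fun b => ?_
  refine htr.of_norm_bounded fun k => ((hX k).norm_apply_le_trace a b).trans ?_
  have := (Complex.le_def.1 (hXY k).trace_nonneg).1
  simp at this
  linarith

theorem hasSum_kronecker_one {m n : Type*} [Fintype m] [DecidableEq n]
    {f : ℕ → Matrix m m ℂ} {a : Matrix m m ℂ} (h : HasSum f a) :
    HasSum (fun k => f k ⊗ₖ (1 : Matrix n n ℂ)) (a ⊗ₖ 1) := by
  refine Pi.hasSum.2 fun x => Pi.hasSum.2 fun y => ?_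
  exact (Pi.hasSum.1 (Pi.hasSum.1 h x.1) y.1).mul_right _

theorem hasSum_one_kronecker {m n : Type*} [Fintype m] [DecidableEq n]
    {f : ℕ → Matrix m m ℂ} {a : Matrix m m ℂ} (h : HasSum f a) :
    HasSum (fun k => (1 : Matrix n n ℂ) ⊗ₖ f k) (1 ⊗ₖ a) := by
  refine Pi.hasSum.2 fun x => Pi.hasSum.2 fun y => ?_
  exact (Pi.hasSum.1 (Pi.hasSum.1 h x.2) y.2).mul_left _

theorem HasSum.conjTranspose_mul_mul {m n : Type*} [Fintype m]
    {f : ℕ → Matrix m m ℂ} {a : Matrix m m ℂ} (h : HasSum f a) (C : Matrix m n ℂ) :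
    HasSum (fun k => Cᴴ * f k * C) (Cᴴ * a * C) :=
  h.map (AddMonoidHom.mk' (fun X : Matrix m m ℂ => Cᴴ * X * C) fun X Y => by
    simp [Matrix.mul_add, Matrix.add_mul])
    ((continuous_const.matrix_mul continuous_id).matrix_mul continuous_const)

/-- Kraus operators `C k` with `∑ₖ (C k)ᴴ C k = 1` turn POVMs `N k` into a POVM. -/
theorem hasSum_conj_povm {ι n : Type*} [Fintype ι] [Fintype n] [DecidableEq n]
    {m : ℕ → Type*} [∀ k, Fintype (m k)] [∀ k, DecidableEq (m k)]
    {C : ∀ k, Matrix (m k) n ℂ} (hC : HasSum (fun k => (C k)ᴴ * C k) 1)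
    {N : ∀ k, ι → Matrix (m k) (m k) ℂ} (hN : ∀ k i, (N k i).PosSemidef)
    (hN1 : ∀ k, ∑ i, N k i = 1) :
    (∀ i, HasSum (fun k => (C k)ᴴ * N k i * C k) (∑' k, (C k)ᴴ * N k i * C k)) ∧
    (∀ i, (∑' k, (C k)ᴴ * N k i * C k).PosSemidef) ∧
      ∑ i, ∑' k, (C k)ᴴ * N k i * C k = 1 := by
  classical
  have hpos : ∀ k i, ((C k)ᴴ * N k i * C k).PosSemidef := fun k i =>
    (hN k i).conjTranspose_mul_mul_same _
  have hsum : ∀ k, ∑ i, (C k)ᴴ * N k i * C k = (C k)ᴴ * C k := fun k => by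
    rw [← Matrix.sum_mul, ← Matrix.mul_sum, hN1, Matrix.mul_one]
  have hS : ∀ i, HasSum (fun k => (C k)ᴴ * N k i * C k) (∑' k, (C k)ᴴ * N k i * C k) := by
    intro i
    refine (summable_of_posSemidef_sub (fun k => hpos k i) (fun k => ?_) hC.summable).hasSum
    rw [← hsum k, ← Finset.add_sum_erase _ _ (Finset.mem_univ i), add_sub_cancel_left]
    exact Matrix.posSemidef_sum _ fun j _ => hpos k j
  refine ⟨hS, fun i => ?_, ?_⟩
  · refine Matrix.PosSemidef.of_dotProduct_mulVec_nonneg ?_ fun x => ?_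
    · refine (hS i).matrix_conjTranspose.unique ?_
      simpa only [fun k => (hpos k i).isHermitian.eq] using hS i
    · have hform : HasSum (fun k => star x ⬝ᵥ ((C k)ᴴ * N k i * C k) *ᵥ x)
          (star x ⬝ᵥ (∑' k, (C k)ᴴ * N k i * C k) *ᵥ x) :=
        (hS i).map (AddMonoidHom.mk' (fun X : Matrix n n ℂ => star x ⬝ᵥ X *ᵥ x) fun X Y => by
          simp [Matrix.add_mulVec])
          (continuous_const.dotProduct (continuous_id.matrix_mulVec continuous_const))
      rw [← hform.tsum_eq]
      exact tsum_nonneg fun k => (hpos k i).dotProduct_mulVec_nonneg x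
  · refine (hasSum_sum fun i _ => hS i).unique ?_
    simpa only [hsum] using hC

end MatrixFacts

/-! ### Protocols implement POVMs. -/

section ProtocolFacts
open scoped ComplexOrder

theorem hasSum_kronecker_one_measurement {d n : ℕ} {e : ℕ → ℕ}
    {K : ∀ k, Matrix (Fin (e k)) (Fin d) ℂ} (hK : IsMeasurement K) :
    HasSum (fun k => (K k ⊗ₖ (1 : Matrix (Fin n) (Fin n) ℂ))ᴴ *
      (K k ⊗ₖ (1 : Matrix (Fin n) (Fin n) ℂ))) 1 := by
  simpa [Matrix.conjTranspose_kronecker, ← Matrix.mul_kronecker_mul] using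
    hasSum_kronecker_one (n := Fin n) hK

theorem hasSum_one_kronecker_measurement {d n : ℕ} {e : ℕ → ℕ}
    {K : ∀ k, Matrix (Fin (e k)) (Fin d) ℂ} (hK : IsMeasurement K) :
    HasSum (fun k => ((1 : Matrix (Fin n) (Fin n) ℂ) ⊗ₖ K k)ᴴ *
      ((1 : Matrix (Fin n) (Fin n) ℂ) ⊗ₖ K k)) 1 := by
  simpa [Matrix.conjTranspose_kronecker, ← Matrix.mul_kronecker_mul] using
    hasSum_one_kronecker (n := Fin n) hK

theorem LOCCProtocol.povm_isPOVM {ι : Type} [Fintype ι] [DecidableEq ι] {r dA dB : ℕ}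
    (P : LOCCProtocol ι r dA dB) :
    (∀ i, (P.povm i).PosSemidef) ∧ ∑ i, P.povm i = 1 := by
  induction P with
  | announce i =>
    refine ⟨fun j => ?_, ?_⟩
    · rcases eq_or_ne j i with rfl | h
      · simpa [LOCCProtocol.povm] using Matrix.PosSemidef.one
      · simpa [LOCCProtocol.povm, h] using Matrix.PosSemidef.zero
    · simp [LOCCProtocol.povm]
  | alice e K hK next ih =>
    exact (hasSum_conj_povm (hasSum_kronecker_one_measurement hK) (fun k => (ih k).1)
      fun k => (ih k).2).2
  | bob e K hK next ih =>
    exact (hasSum_conj_povm (hasSum_one_kronecker_measurement hK) (fun k => (ih k).1)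
      fun k => (ih k).2).2

theorem LOCCProtocol.hasSum_povm_alice {ι : Type} [Fintype ι] [DecidableEq ι] {r dA dB : ℕ}
    {e : ℕ → ℕ} {K : ∀ k, Matrix (Fin (e k)) (Fin dA) ℂ} (hK : IsMeasurement K)
    (next : ∀ k, LOCCProtocol ι r (e k) dB) (i : ι) :
    HasSum (fun k => (K k ⊗ₖ (1 : Matrix (Fin dB) (Fin dB) ℂ))ᴴ * (next k).povm i *
        (K k ⊗ₖ (1 : Matrix (Fin dB) (Fin dB) ℂ)))
      ((LOCCProtocol.alice e K hK next).povm i) :=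
  (hasSum_conj_povm (hasSum_kronecker_one_measurement hK) (fun k => (next k).povm_isPOVM.1)
      fun k => (next k).povm_isPOVM.2).1 i

theorem LOCCProtocol.hasSum_povm_bob {ι : Type} [Fintype ι] [DecidableEq ι] {r dA dB : ℕ}
    {e : ℕ → ℕ} {K : ∀ k, Matrix (Fin (e k)) (Fin dB) ℂ} (hK : IsMeasurement K)
    (next : ∀ k, LOCCProtocol ι r dA (e k)) (i : ι) :
    HasSum (fun k => ((1 : Matrix (Fin dA) (Fin dA) ℂ) ⊗ₖ K k)ᴴ * (next k).povm i *
        ((1 : Matrix (Fin dA) (Fin dA) ℂ) ⊗ₖ K k))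
      ((LOCCProtocol.bob e K hK next).povm i) :=
  (hasSum_conj_povm (hasSum_one_kronecker_measurement hK) (fun k => (next k).povm_isPOVM.1)
      fun k => (next k).povm_isPOVM.2).1 i

end ProtocolFacts

/-! ### Error and deviation of product operators. -/

section Trapping
open scoped ComplexOrder Topology
attribute [local instance] Matrix.normedAddCommGroup Matrix.normedSpace

/-- The total probability weight of wrong answers when the (possibly unnormalized) POVM `M` is used
to discriminate the kets `ψ i`. -/
noncomputable def discriminationError {ι H : Type*} [Fintype ι] [DecidableEq ι] [Fintype H]
    (ψ : ι → H → ℂ) : (ι → Matrix H H ℂ) →ₗ[ℝ] ℝ where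
  toFun M := ∑ i, ∑ j ∈ Finset.univ.erase i, (star (ψ j) ⬝ᵥ M i *ᵥ ψ j).re
  map_add' M N := by simp [Matrix.add_mulVec, Finset.sum_add_distrib]
  map_smul' c M := by simp [-Finset.sum_erase_eq_sub, Matrix.smul_mulVec, Finset.mul_sum]

/-- `M` is a decomposition of `E` into positive semidefinite operators with error `e`. -/
def IsDecomposition {ι H : Type*} [Fintype ι] [DecidableEq ι] [Fintype H] (ψ : ι → H → ℂ)
    (E : Matrix H H ℂ) (e : ℝ) : Prop :=
  ∃ M : ι → Matrix H H ℂ, (∀ i, (M i).PosSemidef) ∧ ∑ i, M i = E ∧ discriminationError ψ M = e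

/-- Distance from `A` to the ray through `Z`, at the same trace. -/
noncomputable def deviation {n : Type*} [Fintype n] (Z A : Matrix n n ℂ) : ℝ :=
  ‖A - A.trace.re • Z‖

section Error
variable {ι H : Type*} [Fintype ι] [DecidableEq ι] [Fintype H] {ψ : ι → H → ℂ}

theorem discriminationError_apply (ψ : ι → H → ℂ) (M : ι → Matrix H H ℂ) :
    discriminationError ψ M =
      ∑ i, ∑ j ∈ Finset.univ.erase i, (star (ψ j) ⬝ᵥ M i *ᵥ ψ j).re := rfl

theorem Matrix.PosSemidef.re_form_nonneg {M : Matrix H H ℂ} (hM : M.PosSemidef) (x : H → ℂ) :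
    0 ≤ (star x ⬝ᵥ M *ᵥ x).re :=
  (Complex.le_def.1 (hM.dotProduct_mulVec_nonneg x)).1

theorem discriminationError_nonneg {M : ι → Matrix H H ℂ} (hM : ∀ i, (M i).PosSemidef) :
    0 ≤ discriminationError ψ M :=
  Finset.sum_nonneg fun i _ => Finset.sum_nonneg fun _ _ => (hM i).re_form_nonneg _

theorem continuous_discriminationError : Continuous (discriminationError ψ) := by
  refine continuous_finsetSum _ fun i _ => continuous_finsetSum _ fun j _ => ?_
  exact Complex.continuous_re.comp
    (continuous_const.dotProduct ((continuous_apply i).matrix_mulVec continuous_const))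

theorem IsDecomposition.nonneg {E : Matrix H H ℂ} {e : ℝ} (h : IsDecomposition ψ E e) : 0 ≤ e := by
  obtain ⟨M, hM, -, rfl⟩ := h
  exact discriminationError_nonneg hM

theorem IsDecomposition.combine {E E' : Matrix H H ℂ} {e e' s t : ℝ} (hs : 0 ≤ s) (ht : 0 ≤ t)
    (h : IsDecomposition ψ E e) (h' : IsDecomposition ψ E' e') :
    IsDecomposition ψ (s • E + t • E') (s * e + t * e') := by
  obtain ⟨M, hM, rfl, rfl⟩ := h
  obtain ⟨M', hM', rfl, rfl⟩ := h'
  refine ⟨s • M + t • M', fun i => ((hM i).smul hs).add ((hM' i).smul ht), ?_, ?_⟩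
  · simp [Finset.sum_add_distrib, Finset.smul_sum]
  · simp

theorem IsDecomposition.smul {E : Matrix H H ℂ} {e s : ℝ} (hs : 0 ≤ s)
    (h : IsDecomposition ψ E e) : IsDecomposition ψ (s • E) (s * e) := by
  simpa using h.combine hs le_rfl h

/-- A decomposition with small error forces small off-diagonal elements. -/
theorem IsDecomposition.norm_sq_offdiag_le {E : Matrix H H ℂ} {e W : ℝ}
    (h : IsDecomposition ψ E e) (hW : ∀ i, (star (ψ i) ⬝ᵥ E *ᵥ ψ i).re ≤ W) {i j : ι}
    (hij : i ≠ j) :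
    ‖star (ψ i) ⬝ᵥ E *ᵥ ψ j‖ ^ 2 ≤ (Fintype.card ι : ℝ) ^ 2 * (e * W) := by
  obtain ⟨M, hM, rfl, rfl⟩ := h
  have hform : ∀ x y : H → ℂ, star x ⬝ᵥ (∑ k, M k) *ᵥ y = ∑ k, star x ⬝ᵥ M k *ᵥ y := fun x y => by
    rw [Matrix.sum_mulVec, dotProduct_sum]
  have hle : ∀ k l, (star (ψ l) ⬝ᵥ M k *ᵥ ψ l).re ≤ W := fun k l => by
    refine le_trans ?_ (hW l)
    rw [hform, Complex.re_sum]
    exact Finset.single_le_sum (f := fun k => (star (ψ l) ⬝ᵥ M k *ᵥ ψ l).re)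
      (fun k _ => (hM k).re_form_nonneg _) (Finset.mem_univ k)
  have herr : ∀ k l, l ≠ k → (star (ψ l) ⬝ᵥ M k *ᵥ ψ l).re ≤ discriminationError ψ M :=
    fun k l hkl => by
    refine le_trans ?_ (Finset.single_le_sum
      (f := fun i => ∑ j ∈ Finset.univ.erase i, (star (ψ j) ⬝ᵥ M i *ᵥ ψ j).re)
      (fun i _ => Finset.sum_nonneg fun j _ => (hM i).re_form_nonneg _) (Finset.mem_univ k))
    exact Finset.single_le_sum (f := fun j => (star (ψ j) ⬝ᵥ M k *ᵥ ψ j).re)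
      (fun j _ => (hM k).re_form_nonneg _) (Finset.mem_erase.2 ⟨hkl, Finset.mem_univ l⟩)
  -- Since `i ≠ j`, outcome `k` is wrong for at least one of the two kets. In Cauchy–Schwarz that
  -- ket contributes the error and the other one contributes `W`.
  have hterm : ∀ k, ‖star (ψ i) ⬝ᵥ M k *ᵥ ψ j‖ ^ 2 ≤ discriminationError ψ M * W := fun k => by
    refine ((hM k).norm_sq_form_le _ _).trans ?_
    rcases eq_or_ne i k with rfl | hik
    · rw [mul_comm]
      exact mul_le_mul (herr _ _ hij.symm) (hle _ _) ((hM _).re_form_nonneg _)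
        (discriminationError_nonneg hM)
    · exact mul_le_mul (herr _ _ hik) (hle _ _) ((hM _).re_form_nonneg _)
        (discriminationError_nonneg hM)
  calc ‖star (ψ i) ⬝ᵥ (∑ k, M k) *ᵥ ψ j‖ ^ 2
      ≤ (∑ k, ‖star (ψ i) ⬝ᵥ M k *ᵥ ψ j‖) ^ 2 := by
        rw [hform]
        exact pow_le_pow_left₀ (norm_nonneg _) (norm_sum_le _ _) 2
    _ ≤ Fintype.card ι * ∑ k, ‖star (ψ i) ⬝ᵥ M k *ᵥ ψ j‖ ^ 2 := sq_sum_le_card_mul_sum_sq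
    _ ≤ Fintype.card ι * ∑ _k : ι, discriminationError ψ M * W := by
        gcongr with k
        exact hterm k
    _ = _ := by
        rw [Finset.sum_const, Finset.card_univ, nsmul_eq_mul]; ring

end Error

/-! ### Crossing the boundary in one round. -/

section Crossing
variable {n : Type*} [Fintype n]

theorem continuous_deviation (Z : Matrix n n ℂ) : Continuous (deviation Z) :=
  (continuous_id.sub ((Complex.continuous_re.comp continuous_id.matrix_trace).smul
    continuous_const)).norm

theorem deviation_smul (Z A : Matrix n n ℂ) {s : ℝ} (hs : 0 ≤ s) :
    deviation Z (s • A) = s * deviation Z A := by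
  have : s • A - (s • A).trace.re • Z = s • (A - A.trace.re • Z) := by
    simp [smul_sub, smul_smul]
  rw [deviation, this, norm_smul, Real.norm_of_nonneg hs, deviation]

/-- If operators at deviation exactly `r` are discriminated badly, then so is an operator at
deviation at most `r` whose parts at deviation at most `r` are all discriminated badly. -/
theorem error_ge_of_hasSum {Z : Matrix n n ℂ} {r δ : ℝ} {G : Matrix n n ℂ → ℝ → Prop}
    (hadd : ∀ A A' e e' s t, 0 ≤ s → 0 ≤ t → G A e → G A' e' →
      G (s • A + t • A') (s * e + t * e'))
    (hbd : ∀ A e, G A e → deviation Z A = r * A.trace.re → δ * A.trace.re ≤ e)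
    {A : Matrix n n ℂ} {e : ℝ} {Ak : ℕ → Matrix n n ℂ} {ek : ℕ → ℝ}
    (hA : HasSum Ak A) (he : HasSum ek e) (hG : G A e) (hGk : ∀ k, G (Ak k) (ek k))
    (hnear : deviation Z A ≤ r * A.trace.re)
    (hk : ∀ k, deviation Z (Ak k) ≤ r * (Ak k).trace.re → δ * (Ak k).trace.re ≤ ek k) :
    δ * A.trace.re ≤ e := by
  by_contra! hlt
  have htr : HasSum (fun k => (Ak k).trace.re) A.trace.re :=
    hA.map (Complex.reCLM.toLinearMap.toAddMonoidHom.comp (Matrix.traceAddMonoidHom n ℂ))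
      (Complex.continuous_re.comp continuous_id.matrix_trace)
  refine hlt.not_ge (hasSum_le (fun k => ?_) (htr.mul_left δ) he)
  by_cases hkn : deviation Z (Ak k) ≤ r * (Ak k).trace.re
  · exact hk k hkn
  push Not at hkn
  -- The child lies outside and the parent does not, so the segment between them meets the boundary.
  let p : ℝ → Matrix n n ℂ := fun t => (1 - t) • A + t • Ak k
  have hp : Continuous p := by fun_prop
  have hf : Continuous fun t => deviation Z (p t) - r * (p t).trace.re :=
    ((continuous_deviation Z).comp hp).sub
      (continuous_const.mul (Complex.continuous_re.comp hp.matrix_trace))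
  obtain ⟨t, ⟨ht0, ht1⟩, ht⟩ := intermediate_value_Icc zero_le_one hf.continuousOn
    (show (0 : ℝ) ∈ _ by
      simp only [p, Set.mem_Icc]
      constructor <;> simp <;> linarith)
  have hb := hbd (p t) _ (hadd _ _ _ _ _ _ (sub_nonneg.2 ht1) ht0 hG (hGk k)) (sub_eq_zero.1 ht)
  have htrace : (p t).trace.re = (1 - t) * A.trace.re + t * (Ak k).trace.re := by
    simp [p]
  rw [htrace] at hb
  -- At `t = 0` the parent itself is on the boundary, contradicting `hlt`. Otherwise the mixture is
  -- bad while the parent is good, so the child is bad.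
  rcases ht0.eq_or_lt with rfl | htpos
  · linarith
  · nlinarith

end Crossing

/-! ### Uniform error bounds from compactness and homogeneity. -/

section Compactness
variable {ι mA mB : Type*} [Fintype ι] [DecidableEq ι] [Fintype mA] [Fintype mB]
  {ψ : ι → mA × mB → ℂ} {ZA : Matrix mA mA ℂ} {ZB : Matrix mB mB ℂ} {r : ℝ}

theorem continuous_kronecker_form (x y : mA × mB → ℂ) :
    Continuous fun p : Matrix mA mA ℂ × Matrix mB mB ℂ => star x ⬝ᵥ (p.1 ⊗ₖ p.2) *ᵥ y := by
  have : Continuous fun p : Matrix mA mA ℂ × Matrix mB mB ℂ => p.1 ⊗ₖ p.2 :=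
    continuous_matrix fun a b =>
      (continuous_fst.matrix_elem a.1 b.1).mul (continuous_snd.matrix_elem a.2 b.2)
  exact continuous_const.dotProduct (this.matrix_mulVec continuous_const)

/-- On the compact boundary the sum of squared off-diagonal elements is positive by rigidity, hence
bounded below; a small error would make it small. -/
theorem exists_error_ge_of_trace_eq_one (hr : 0 < r)
    (hrig : ∀ A B, A.trace = 1 → B.trace = 1 → ‖A - ZA‖ ≤ r → ‖B - ZB‖ ≤ r →
      (∀ i j, i ≠ j → star (ψ i) ⬝ᵥ (A ⊗ₖ B) *ᵥ ψ j = 0) → A = ZA ∧ B = ZB) :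
    ∃ δ > 0, ∀ A B e, A.trace = 1 → B.trace = 1 → ‖A - ZA‖ ≤ r → ‖B - ZB‖ ≤ r →
      (‖A - ZA‖ = r ∨ ‖B - ZB‖ = r) → IsDecomposition ψ (A ⊗ₖ B) e → δ ≤ e := by
  let S : Set (Matrix mA mA ℂ × Matrix mB mB ℂ) :=
    (Metric.closedBall ZA r ×ˢ Metric.closedBall ZB r) ∩
      {p | p.1.trace = 1 ∧ p.2.trace = 1 ∧ (‖p.1 - ZA‖ = r ∨ ‖p.2 - ZB‖ = r)}
  have hS : IsCompact S := by
    have : ProperSpace (Matrix mA mA ℂ) := inferInstanceAs (ProperSpace (mA → mA → ℂ))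
    have : ProperSpace (Matrix mB mB ℂ) := inferInstanceAs (ProperSpace (mB → mB → ℂ))
    refine ((isCompact_closedBall ZA r).prod (isCompact_closedBall ZB r)).inter_right ?_
    refine (isClosed_eq continuous_fst.matrix_trace continuous_const).inter
      ((isClosed_eq continuous_snd.matrix_trace continuous_const).inter
        ((isClosed_eq ?_ continuous_const).union (isClosed_eq ?_ continuous_const)))
    · exact (continuous_fst.sub continuous_const).norm
    · exact (continuous_snd.sub continuous_const).norm
  let F : Matrix mA mA ℂ × Matrix mB mB ℂ → ℝ := fun p =>
    ∑ i, ∑ j ∈ Finset.univ.erase i, ‖star (ψ i) ⬝ᵥ (p.1 ⊗ₖ p.2) *ᵥ ψ j‖ ^ 2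
  have hF : Continuous F := continuous_finsetSum _ fun i _ => continuous_finsetSum _ fun j _ =>
    ((continuous_kronecker_form _ _).norm.pow 2)
  have hFpos : ∀ p ∈ S, 0 < F p := by
    rintro ⟨A, B⟩ ⟨⟨hA, hB⟩, htA, htB, hor⟩
    rw [mem_closedBall_iff_norm] at hA hB
    refine lt_of_le_of_ne (by positivity) fun h0 => ?_
    have hz := hrig A B htA htB hA hB fun i j hij => by
      have h1 := (Finset.sum_eq_zero_iff_of_nonneg fun i _ => by positivity).1 h0.symm i
        (Finset.mem_univ i)
      have h2 := (Finset.sum_eq_zero_iff_of_nonneg fun i _ => by positivity).1 h1 j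
        (Finset.mem_erase.2 ⟨hij.symm, Finset.mem_univ j⟩)
      simpa using h2
    rcases hor with h | h
    · simp [hz.1] at h; exact hr.ne h
    · simp [hz.2] at h; exact hr.ne h
  obtain ⟨c, hc, hcF⟩ := hS.exists_forall_le' hF.continuousOn hFpos
  let D : Matrix mA mA ℂ × Matrix mB mB ℂ → ℝ := fun p =>
    ∑ i, |(star (ψ i) ⬝ᵥ (p.1 ⊗ₖ p.2) *ᵥ ψ i).re|
  have hD : Continuous D := continuous_finsetSum _ fun i _ =>
    (Complex.continuous_re.comp (continuous_kronecker_form _ _)).abs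
  obtain ⟨W, hW⟩ := hS.exists_bound_of_continuousOn hD.continuousOn
  set N : ℝ := (Fintype.card ι : ℝ) with hN
  set K : ℝ := N * (N * (N ^ 2 * max W 0)) with hK
  have hK0 : 0 ≤ K := by positivity
  -- The summand `1` keeps the denominator positive even when `K = 0`.
  refine ⟨c / (K + 1), by positivity, fun A B e htA htB hA hB hor h => ?_⟩
  have hmem : (A, B) ∈ S := ⟨⟨mem_closedBall_iff_norm.2 hA, mem_closedBall_iff_norm.2 hB⟩,
    htA, htB, hor⟩
  have hdiag : ∀ i, (star (ψ i) ⬝ᵥ (A ⊗ₖ B) *ᵥ ψ i).re ≤ max W 0 := fun i => by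
    refine (le_abs_self _).trans (((Finset.single_le_sum
      (f := fun i => |(star (ψ i) ⬝ᵥ (A ⊗ₖ B) *ᵥ ψ i).re|) (fun i _ => abs_nonneg _)
      (Finset.mem_univ i)).trans (le_abs_self _)).trans ((hW _ hmem).trans (le_max_left _ _)))
  have he := h.nonneg
  have hFle : F (A, B) ≤ K * e := by
    calc F (A, B) ≤ ∑ i : ι, ∑ j ∈ Finset.univ.erase i, N ^ 2 * (e * max W 0) :=
          Finset.sum_le_sum fun i _ => Finset.sum_le_sum fun j hj =>
            h.norm_sq_offdiag_le hdiag (Finset.ne_of_mem_erase hj).symm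
      _ ≤ ∑ i : ι, ∑ j : ι, N ^ 2 * (e * max W 0) :=
          Finset.sum_le_sum fun i _ => Finset.sum_le_sum_of_subset_of_nonneg
            (Finset.erase_subset _ _) fun _ _ _ => by positivity
      _ = K * e := by simp [hK, ← hN]; ring
  have := hcF _ hmem
  rw [div_le_iff₀ (by positivity)]
  nlinarith

theorem Matrix.PosSemidef.trace_eq_re {n : Type*} [Fintype n] {A : Matrix n n ℂ}
    (hA : A.PosSemidef) : A.trace = (A.trace.re : ℂ) :=
  Complex.ext rfl (by simpa using (Complex.le_def.1 hA.trace_nonneg).2.symm)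

theorem exists_normalization {n : Type*} [Fintype n] {A : Matrix n n ℂ} (Z : Matrix n n ℂ)
    (hA : A.PosSemidef) (hpos : 0 < A.trace.re) :
    ∃ A' : Matrix n n ℂ, A = A.trace.re • A' ∧ A'.trace = 1 ∧
      deviation Z A = ‖A' - Z‖ * A.trace.re := by
  have ht : (A.trace.re⁻¹ • A).trace = 1 := by
    rw [Matrix.trace_smul, Complex.real_smul, hA.trace_eq_re, Complex.ofReal_re,
      ← Complex.ofReal_mul, inv_mul_cancel₀ hpos.ne', Complex.ofReal_one]
  have hA' : A = A.trace.re • A.trace.re⁻¹ • A := by rw [smul_inv_smul₀ hpos.ne']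
  refine ⟨A.trace.re⁻¹ • A, hA', ht, ?_⟩
  conv_lhs => rw [hA', deviation_smul _ _ hpos.le]
  rw [deviation, ht, Complex.one_re, one_smul, mul_comm]

/-- Everything is homogeneous of degree one in `A` and in `B`, so the bound at trace one extends to
the cone; at trace zero it reduces to nonnegativity of the error. -/
theorem exists_error_ge (hr : 0 < r)
    (hrig : ∀ A B, A.trace = 1 → B.trace = 1 → ‖A - ZA‖ ≤ r → ‖B - ZB‖ ≤ r →
      (∀ i j, i ≠ j → star (ψ i) ⬝ᵥ (A ⊗ₖ B) *ᵥ ψ j = 0) → A = ZA ∧ B = ZB) :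
    ∃ δ > 0, ∀ A B e, A.PosSemidef → B.PosSemidef → deviation ZA A ≤ r * A.trace.re →
      deviation ZB B ≤ r * B.trace.re →
      (deviation ZA A = r * A.trace.re ∨ deviation ZB B = r * B.trace.re) →
      IsDecomposition ψ (A ⊗ₖ B) e → δ * A.trace.re * B.trace.re ≤ e := by
  obtain ⟨δ, hδ, h⟩ := exists_error_ge_of_trace_eq_one hr hrig
  refine ⟨δ, hδ, fun A B e hA hB hdA hdB hor hdec => ?_⟩
  have h0A : 0 ≤ A.trace.re := (Complex.le_def.1 hA.trace_nonneg).1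
  have h0B : 0 ≤ B.trace.re := (Complex.le_def.1 hB.trace_nonneg).1
  rcases h0A.eq_or_lt with hz | hpA
  · simpa [← hz] using hdec.nonneg
  rcases h0B.eq_or_lt with hz | hpB
  · simpa [← hz] using hdec.nonneg
  obtain ⟨A', hAA', htA, hnA⟩ := exists_normalization ZA hA hpA
  obtain ⟨B', hBB', htB, hnB⟩ := exists_normalization ZB hB hpB
  rw [hnA] at hdA hor
  rw [hnB] at hdB hor
  generalize A.trace.re = a at *
  generalize B.trace.re = b at *
  have key := h A' B' ((a * b)⁻¹ * e) htA htB (le_of_mul_le_mul_right hdA hpA)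
    (le_of_mul_le_mul_right hdB hpB)
    (hor.imp (mul_right_cancel₀ hpA.ne') (mul_right_cancel₀ hpB.ne'))
    (by
      have := hdec.smul (s := (a * b)⁻¹) (by positivity)
      rwa [hAA', hBB', Matrix.kronecker_smul, Matrix.smul_kronecker, smul_smul b, mul_comm b,
        inv_smul_smul₀ (by positivity)] at this)
  calc δ * a * b ≤ ((a * b)⁻¹ * e) * a * b := by gcongr
    _ = e := by field_simp

theorem offdiag_sum_ge {c : ℝ}
    (hleaf : ∀ A B, ‖A - ZA‖ ≤ r → ‖B - ZB‖ ≤ r → ∀ i,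
      c ≤ ∑ j ∈ Finset.univ.erase i, (star (ψ j) ⬝ᵥ (A ⊗ₖ B) *ᵥ ψ j).re)
    {A : Matrix mA mA ℂ} {B : Matrix mB mB ℂ} (hA : A.PosSemidef) (hB : B.PosSemidef)
    (hdA : deviation ZA A ≤ r * A.trace.re) (hdB : deviation ZB B ≤ r * B.trace.re) (i : ι) :
    c * A.trace.re * B.trace.re ≤
      ∑ j ∈ Finset.univ.erase i, (star (ψ j) ⬝ᵥ (A ⊗ₖ B) *ᵥ ψ j).re := by
  have h0A : 0 ≤ A.trace.re := (Complex.le_def.1 hA.trace_nonneg).1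
  have h0B : 0 ≤ B.trace.re := (Complex.le_def.1 hB.trace_nonneg).1
  have hnn : 0 ≤ ∑ j ∈ Finset.univ.erase i, (star (ψ j) ⬝ᵥ (A ⊗ₖ B) *ᵥ ψ j).re :=
    Finset.sum_nonneg fun j _ => (hA.kronecker hB).re_form_nonneg _
  rcases h0A.eq_or_lt with hz | hpA
  · simpa only [← hz, mul_zero, zero_mul] using hnn
  rcases h0B.eq_or_lt with hz | hpB
  · simpa only [← hz, mul_zero, zero_mul] using hnn
  obtain ⟨A', hAA', htA, hnA⟩ := exists_normalization ZA hA hpA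
  obtain ⟨B', hBB', htB, hnB⟩ := exists_normalization ZB hB hpB
  rw [hnA] at hdA
  rw [hnB] at hdB
  generalize A.trace.re = a at *
  generalize B.trace.re = b at *
  have h := hleaf A' B' (le_of_mul_le_mul_right hdA hpA) (le_of_mul_le_mul_right hdB hpB) i
  rw [hAA', hBB', Matrix.kronecker_smul, Matrix.smul_kronecker]
  simp only [Matrix.smul_mulVec, dotProduct_smul, Complex.smul_re, smul_eq_mul, ← Finset.mul_sum]
  calc c * a * b = b * (a * c) := by ring
    _ ≤ _ := by gcongr

end Compactness

end Trapping

/-! ### Induction over protocols and passage to the closure. -/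

section Protocols
open scoped ComplexOrder Topology
attribute [local instance] Matrix.normedAddCommGroup Matrix.normedSpace

variable {ι : Type} [Fintype ι] [DecidableEq ι] {dA dB : ℕ} {ψ : ι → Fin dA × Fin dB → ℂ}
  {ZA : Matrix (Fin dA) (Fin dA) ℂ} {ZB : Matrix (Fin dB) (Fin dB) ℂ} {r δ : ℝ}

/-- Pulling the POVM of the remaining protocol back along the Kraus operators turns a branch into
data that can be mixed convexly, with no need for a protocol realizing the mixture. -/
theorem LOCCProtocol.isDecomposition {s dA' dB' : ℕ} (P : LOCCProtocol ι s dA' dB')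
    (ψ : ι → Fin dA × Fin dB → ℂ)
    (KA : Matrix (Fin dA') (Fin dA) ℂ) (KB : Matrix (Fin dB') (Fin dB) ℂ) :
    IsDecomposition ψ ((KAᴴ * KA) ⊗ₖ (KBᴴ * KB))
      (discriminationError ψ fun i => (KA ⊗ₖ KB)ᴴ * P.povm i * (KA ⊗ₖ KB)) := by
  refine ⟨_, fun i => (P.povm_isPOVM.1 i).conjTranspose_mul_mul_same _, ?_, rfl⟩
  rw [← Matrix.sum_mul, ← Matrix.mul_sum, P.povm_isPOVM.2, Matrix.mul_one,
    Matrix.conjTranspose_kronecker, ← Matrix.mul_kronecker_mul]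

theorem hasSum_discriminationError {M : ℕ → ι → Matrix (Fin dA × Fin dB) (Fin dA × Fin dB) ℂ}
    {N : ι → Matrix (Fin dA × Fin dB) (Fin dA × Fin dB) ℂ}
    (h : ∀ i, HasSum (fun k => M k i) (N i)) :
    HasSum (fun k => discriminationError ψ (M k)) (discriminationError ψ N) :=
  (Pi.hasSum.2 h).map (discriminationError ψ) continuous_discriminationError

theorem conjTranspose_mul_conjTranspose_mul_mul {l m n : Type*} [Fintype l] [Fintype m]
    (X : Matrix m n ℂ) (Y : Matrix l m ℂ) (N : Matrix l l ℂ) :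
    Xᴴ * (Yᴴ * N * Y) * X = (Y * X)ᴴ * N * (Y * X) := by
  simp only [Matrix.conjTranspose_mul, Matrix.mul_assoc]

theorem IsMeasurement.hasSum_conj {d n : ℕ} {e : ℕ → ℕ} {K : ∀ k, Matrix (Fin (e k)) (Fin d) ℂ}
    (hK : IsMeasurement K) (C : Matrix (Fin d) (Fin n) ℂ) :
    HasSum (fun k => (K k * C)ᴴ * (K k * C)) (Cᴴ * C) := by
  simpa only [Matrix.conjTranspose_mul, Matrix.mul_assoc, Matrix.one_mul] using
    HasSum.conjTranspose_mul_mul hK C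

theorem LOCCProtocol.hasSum_error_alice {s dA' dB' : ℕ} {e : ℕ → ℕ}
    {K : ∀ k, Matrix (Fin (e k)) (Fin dA') ℂ} (hK : IsMeasurement K)
    (next : ∀ k, LOCCProtocol ι s (e k) dB')
    (KA : Matrix (Fin dA') (Fin dA) ℂ) (KB : Matrix (Fin dB') (Fin dB) ℂ) :
    HasSum (fun k => discriminationError ψ fun i =>
        ((K k * KA) ⊗ₖ KB)ᴴ * (next k).povm i * ((K k * KA) ⊗ₖ KB))
      (discriminationError ψ fun i =>
        (KA ⊗ₖ KB)ᴴ * (LOCCProtocol.alice e K hK next).povm i * (KA ⊗ₖ KB)) := by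
  refine hasSum_discriminationError fun i => ?_
  have h := (LOCCProtocol.hasSum_povm_alice hK next i).conjTranspose_mul_mul (KA ⊗ₖ KB)
  have hk : ∀ k, (K k ⊗ₖ (1 : Matrix (Fin dB') (Fin dB') ℂ)) * (KA ⊗ₖ KB) = (K k * KA) ⊗ₖ KB :=
    fun k => by rw [← Matrix.mul_kronecker_mul, Matrix.one_mul]
  refine h.congr_fun fun k => ?_
  rw [conjTranspose_mul_conjTranspose_mul_mul, hk]

theorem LOCCProtocol.hasSum_error_bob {s dA' dB' : ℕ} {e : ℕ → ℕ}
    {K : ∀ k, Matrix (Fin (e k)) (Fin dB') ℂ} (hK : IsMeasurement K)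
    (next : ∀ k, LOCCProtocol ι s dA' (e k))
    (KA : Matrix (Fin dA') (Fin dA) ℂ) (KB : Matrix (Fin dB') (Fin dB) ℂ) :
    HasSum (fun k => discriminationError ψ fun i =>
        (KA ⊗ₖ (K k * KB))ᴴ * (next k).povm i * (KA ⊗ₖ (K k * KB)))
      (discriminationError ψ fun i =>
        (KA ⊗ₖ KB)ᴴ * (LOCCProtocol.bob e K hK next).povm i * (KA ⊗ₖ KB)) := by
  refine hasSum_discriminationError fun i => ?_
  have h := (LOCCProtocol.hasSum_povm_bob hK next i).conjTranspose_mul_mul (KA ⊗ₖ KB)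
  have hk : ∀ k, ((1 : Matrix (Fin dA') (Fin dA') ℂ) ⊗ₖ K k) * (KA ⊗ₖ KB) = KA ⊗ₖ (K k * KB) :=
    fun k => by rw [← Matrix.mul_kronecker_mul, Matrix.one_mul]
  refine h.congr_fun fun k => ?_
  rw [conjTranspose_mul_conjTranspose_mul_mul, hk]

/-- A protocol started near the center never leaves its neighborhood without making an error. -/
theorem LOCCProtocol.error_ge
    (hbd : ∀ A B e, A.PosSemidef → B.PosSemidef → deviation ZA A ≤ r * A.trace.re →
      deviation ZB B ≤ r * B.trace.re →
      (deviation ZA A = r * A.trace.re ∨ deviation ZB B = r * B.trace.re) →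
      IsDecomposition ψ (A ⊗ₖ B) e → δ * A.trace.re * B.trace.re ≤ e)
    (hleaf : ∀ A B, A.PosSemidef → B.PosSemidef → deviation ZA A ≤ r * A.trace.re →
      deviation ZB B ≤ r * B.trace.re → ∀ i, δ * A.trace.re * B.trace.re ≤
        ∑ j ∈ Finset.univ.erase i, (star (ψ j) ⬝ᵥ (A ⊗ₖ B) *ᵥ ψ j).re)
    {s dA' dB' : ℕ} (P : LOCCProtocol ι s dA' dB')
    (KA : Matrix (Fin dA') (Fin dA) ℂ) (KB : Matrix (Fin dB') (Fin dB) ℂ)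
    (hA : deviation ZA (KAᴴ * KA) ≤ r * (KAᴴ * KA).trace.re)
    (hB : deviation ZB (KBᴴ * KB) ≤ r * (KBᴴ * KB).trace.re) :
    δ * (KAᴴ * KA).trace.re * (KBᴴ * KB).trace.re ≤
      discriminationError ψ fun i => (KA ⊗ₖ KB)ᴴ * P.povm i * (KA ⊗ₖ KB) := by
  induction P with
  | @announce s dA' dB' i =>
    refine (hleaf _ _ (Matrix.posSemidef_conjTranspose_mul_self KA)
      (Matrix.posSemidef_conjTranspose_mul_self KB) hA hB i).trans ?_
    obtain ⟨hpos, -⟩ := (LOCCProtocol.announce i : LOCCProtocol ι s dA' dB').povm_isPOVM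
    -- Only the announced label `i` carries weight, so the error is at least its row.
    rw [discriminationError_apply]
    refine le_trans (le_of_eq ?_) (Finset.single_le_sum (fun l _ => Finset.sum_nonneg fun j _ =>
      ((hpos l).conjTranspose_mul_mul_same (KA ⊗ₖ KB)).re_form_nonneg _) (Finset.mem_univ i))
    simp only [LOCCProtocol.povm, Pi.single_eq_same, Matrix.mul_one,
      Matrix.conjTranspose_kronecker, ← Matrix.mul_kronecker_mul]
  | @alice s dA' dB' e K hK next ih =>
    -- Bob's trace is constant during Alice's round and is absorbed into the constant.
    rw [mul_right_comm]
    refine error_ge_of_hasSum (Z := ZA) (r := r)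
      (G := fun A e => A.PosSemidef ∧ IsDecomposition ψ (A ⊗ₖ (KBᴴ * KB)) e)
      ?_ ?_ (hK.hasSum_conj KA) (LOCCProtocol.hasSum_error_alice hK next KA KB) ?_ ?_ hA ?_
    · rintro A A' e e' s t hs ht ⟨hA, h⟩ ⟨hA', h'⟩
      refine ⟨(hA.smul hs).add (hA'.smul ht), ?_⟩
      rw [Matrix.add_kronecker, Matrix.smul_kronecker, Matrix.smul_kronecker]
      exact h.combine hs ht h'
    · rintro A e ⟨hA, h⟩ hdev
      rw [mul_right_comm]
      exact hbd A _ e hA (Matrix.posSemidef_conjTranspose_mul_self KB) hdev.le hB (.inl hdev) h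
    · exact ⟨Matrix.posSemidef_conjTranspose_mul_self KA, LOCCProtocol.isDecomposition _ _ _ _⟩
    · exact fun k => ⟨Matrix.posSemidef_conjTranspose_mul_self _,
        LOCCProtocol.isDecomposition _ _ _ _⟩
    · intro k hk
      rw [mul_right_comm]
      exact ih k (K k * KA) KB hk hB
  | @bob s dA' dB' e K hK next ih =>
    refine error_ge_of_hasSum (Z := ZB) (r := r)
      (G := fun B e => B.PosSemidef ∧ IsDecomposition ψ ((KAᴴ * KA) ⊗ₖ B) e)
      ?_ ?_ (hK.hasSum_conj KB) (LOCCProtocol.hasSum_error_bob hK next KA KB) ?_ ?_ hB ?_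
    · rintro B B' e e' s t hs ht ⟨hB, h⟩ ⟨hB', h'⟩
      refine ⟨(hB.smul hs).add (hB'.smul ht), ?_⟩
      rw [Matrix.kronecker_add, Matrix.kronecker_smul, Matrix.kronecker_smul]
      exact h.combine hs ht h'
    · rintro B e ⟨hB, h⟩ hdev
      exact hbd _ B e (Matrix.posSemidef_conjTranspose_mul_self KA) hB hA hdev.le (.inr hdev) h
    · exact ⟨Matrix.posSemidef_conjTranspose_mul_self KB, LOCCProtocol.isDecomposition _ _ _ _⟩
    · exact fun k => ⟨Matrix.posSemidef_conjTranspose_mul_self _,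
        LOCCProtocol.isDecomposition _ _ _ _⟩
    · exact fun k hk => ih k KA (K k * KB) hA hk

theorem trace_mul_pureState {H : Type} [Fintype H] (M : Matrix H H ℂ) (x : H → ℂ) :
    (M * pureState x).trace = star x ⬝ᵥ M *ᵥ x := by
  rw [pureState, Matrix.mul_vecMulVec, Matrix.trace_vecMulVec, dotProduct_comm]

theorem discriminationError_of_sum_eq_one {H : Type} [Fintype H] [DecidableEq H] {ψ : ι → H → ℂ}
    (hnorm : ∀ i, star (ψ i) ⬝ᵥ ψ i = 1) {M : ι → Matrix H H ℂ} (hM : ∑ i, M i = 1) :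
    discriminationError ψ M = Fintype.card ι - ∑ i, (M i * pureState (ψ i)).trace.re := by
  simp only [discriminationError_apply, Finset.sum_erase_eq_sub (Finset.mem_univ _),
    Finset.sum_sub_distrib, trace_mul_pureState]
  rw [Finset.sum_comm]
  congr 1
  have : ∀ j, ∑ i, (star (ψ j) ⬝ᵥ M i *ᵥ ψ j).re = 1 := fun j => by
    rw [← Complex.re_sum, ← dotProduct_sum, ← Matrix.sum_mulVec, hM, Matrix.one_mulVec, hnorm,
      Complex.one_re]
  simp [this]

/-- Kets cannot be discriminated by asymptotic LOCC if the identity is, up to scaling, isolated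
among the product operators that keep them orthogonal. -/
theorem not_discriminableByAsymptoticLOCC [Nontrivial ι] [NeZero dA] [NeZero dB]
    (hnorm : ∀ i, star (ψ i) ⬝ᵥ ψ i = 1)
    (hiso : ∀ᶠ p : Matrix (Fin dA) (Fin dA) ℂ × Matrix (Fin dB) (Fin dB) ℂ in
      𝓝 ((dA : ℂ)⁻¹ • 1, (dB : ℂ)⁻¹ • 1), p.1.trace = 1 → p.2.trace = 1 →
        (∀ i j, i ≠ j → star (ψ i) ⬝ᵥ (p.1 ⊗ₖ p.2) *ᵥ ψ j = 0) →
        p = ((dA : ℂ)⁻¹ • 1, (dB : ℂ)⁻¹ • 1)) :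
    ¬ DiscriminableByAsymptoticLOCC (fun i => pureState (ψ i)) := by
  set ZA : Matrix (Fin dA) (Fin dA) ℂ := (dA : ℂ)⁻¹ • 1 with hZA
  set ZB : Matrix (Fin dB) (Fin dB) ℂ := (dB : ℂ)⁻¹ • 1 with hZB
  have hdA : (0 : ℝ) < dA := Nat.cast_pos.2 (NeZero.pos dA)
  have hdB : (0 : ℝ) < dB := Nat.cast_pos.2 (NeZero.pos dB)
  obtain ⟨c, hc, hleaf⟩ : ∃ c > 0, ∀ᶠ p in 𝓝 (ZA, ZB), ∀ i,
      c ≤ ∑ j ∈ Finset.univ.erase i, (star (ψ j) ⬝ᵥ (p.1 ⊗ₖ p.2) *ᵥ ψ j).re := by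
    have hval : ∀ j, (star (ψ j) ⬝ᵥ (ZA ⊗ₖ ZB) *ᵥ ψ j).re = (dA : ℝ)⁻¹ * (dB : ℝ)⁻¹ := fun j => by
      rw [hZA, hZB, Matrix.smul_kronecker, Matrix.kronecker_smul, Matrix.one_kronecker_one,
        smul_smul, Matrix.smul_mulVec, Matrix.one_mulVec, dotProduct_smul, hnorm]
      simp
    -- Half the weight of a single ket at the center: the inequality is strict there and so persists
    -- nearby.
    refine ⟨(dA : ℝ)⁻¹ * (dB : ℝ)⁻¹ / 2, by positivity, Filter.eventually_all.2 fun i => ?_⟩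
    have hcont : Continuous fun p : Matrix (Fin dA) (Fin dA) ℂ × Matrix (Fin dB) (Fin dB) ℂ =>
        ∑ j ∈ Finset.univ.erase i, (star (ψ j) ⬝ᵥ (p.1 ⊗ₖ p.2) *ᵥ ψ j).re :=
      continuous_finsetSum _ fun j _ =>
        Complex.continuous_re.comp (continuous_kronecker_form _ _)
    refine (hcont.tendsto (ZA, ZB)).eventually (Ici_mem_nhds ?_)
    obtain ⟨j, hj⟩ := exists_ne i
    have hpos : 0 < (dA : ℝ)⁻¹ * (dB : ℝ)⁻¹ := by positivity
    calc _ < (star (ψ j) ⬝ᵥ (ZA ⊗ₖ ZB) *ᵥ ψ j).re := by rw [hval]; exact half_lt_self hpos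
      _ ≤ _ := Finset.single_le_sum (f := fun j => (star (ψ j) ⬝ᵥ (ZA ⊗ₖ ZB) *ᵥ ψ j).re)
          (fun j _ => by rw [hval]; exact hpos.le) (Finset.mem_erase.2 ⟨hj, Finset.mem_univ j⟩)
  obtain ⟨r, hr, hball⟩ := Metric.nhds_basis_closedBall.eventually_iff.1 (hiso.and hleaf)
  have hmem : ∀ A B, ‖A - ZA‖ ≤ r → ‖B - ZB‖ ≤ r → (A, B) ∈ Metric.closedBall (ZA, ZB) r :=
    fun A B hA hB => by
      rw [← closedBall_prod_same]
      exact ⟨mem_closedBall_iff_norm.2 hA, mem_closedBall_iff_norm.2 hB⟩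
  obtain ⟨δ, hδ, hbd⟩ := exists_error_ge (ψ := ψ) hr fun A B hA hB hA' hB' h =>
    Prod.ext_iff.1 ((hball (hmem A B hA' hB')).1 hA hB h)
  have hmin : ∀ {a b : ℝ}, 0 ≤ a → 0 ≤ b → min δ c * a * b ≤ δ * a * b ∧
      min δ c * a * b ≤ c * a * b := fun ha hb =>
    ⟨by gcongr; exact min_le_left _ _, by gcongr; exact min_le_right _ _⟩
  have htr : ∀ {n : ℕ} {A : Matrix (Fin n) (Fin n) ℂ}, A.PosSemidef → 0 ≤ A.trace.re := fun hA =>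
    (Complex.le_def.1 hA.trace_nonneg).1
  have hdev : ∀ (n : ℕ) [NeZero n], deviation ((n : ℂ)⁻¹ • (1 : Matrix (Fin n) (Fin n) ℂ))
      ((1 : Matrix (Fin n) (Fin n) ℂ)ᴴ * 1) = 0 := fun n _ => by
    have h0 : (n : ℂ) ≠ 0 := NeZero.ne _
    have : ((n : ℝ) • (n : ℂ)⁻¹ • (1 : Matrix (Fin n) (Fin n) ℂ)) = 1 := by
      ext a b
      simp [h0]
    simp [deviation, this]
  have hfin : ∀ M ∈ finiteLOCC ι dA dB,
      min δ c * dA * dB ≤ Fintype.card ι - ∑ i, (M i * pureState (ψ i)).trace.re := by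
    rintro _ ⟨s, P, rfl⟩
    rw [← discriminationError_of_sum_eq_one hnorm P.povm_isPOVM.2]
    have := P.error_ge (ψ := ψ) (ZA := ZA) (ZB := ZB) (r := r) (δ := min δ c)
      (fun A B e hA hB h1 h2 h3 h4 =>
        (hmin (htr hA) (htr hB)).1.trans (hbd A B e hA hB h1 h2 h3 h4))
      (fun A B hA hB h1 h2 i => (hmin (htr hA) (htr hB)).2.trans
        (offdiag_sum_ge (fun A B hA hB => (hball (hmem A B hA hB)).2) hA hB h1 h2 i))
      1 1 (by rw [hdev]; simp; positivity) (by rw [hdev]; simp; positivity)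
    simpa using this
  rintro ⟨M, hM, hdisc⟩
  have hclosed : IsClosed {M : ι → Matrix (Fin dA × Fin dB) (Fin dA × Fin dB) ℂ |
      min δ c * dA * dB ≤ Fintype.card ι - ∑ i, (M i * pureState (ψ i)).trace.re} := by
    refine isClosed_le continuous_const (continuous_const.sub
      (continuous_finsetSum _ fun i _ => Complex.continuous_re.comp ?_))
    exact ((continuous_apply i).matrix_mul continuous_const).matrix_trace
  have hle : min δ c * dA * dB ≤ Fintype.card ι - ∑ i, (M i * pureState (ψ i)).trace.re :=
    closure_minimal hfin hclosed hM
  have hz : ∀ i, (M i * pureState (ψ i)).trace.re = 1 := fun i => by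
    rw [hdisc i, Complex.one_re]
  simp only [hz, Finset.sum_const, Finset.card_univ, nsmul_eq_mul, mul_one, sub_self] at hle
  have : 0 < min δ c * dA * dB := mul_pos (mul_pos (lt_min hδ hc) hdA) hdB
  linarith

end Protocols

/-! ### The pentagon of local kets. -/

section Pentagon

variable {θ γ φ : ℝ}

/-- Modulo 5 this relabelling exchanges cyclic distances one and two, so Bob's pentagon is the
complement of Alice's and her lemmas serve for both. -/
theorem bobKet_apply (θ γ φ : ℝ) (i : Fin 5) : bobKet θ γ φ i = aliceKet θ γ φ (2 * i + 1) := by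
  fin_cases i <;> rfl

theorem upbNorm_ne_zero (hcγ : Real.cos γ ≠ 0) : (upbNorm θ γ : ℂ) ≠ 0 := by
  rw [upbNorm, Complex.ofReal_ne_zero]
  positivity

theorem star_exp_I_mul_exp_I (φ : ℝ) :
    (starRingEnd ℂ) (Complex.exp (Complex.I * φ)) * Complex.exp (Complex.I * φ) = 1 := by
  rw [← Complex.exp_conj, ← Complex.exp_add]
  simp

/-- Local kets of which any three are linearly independent have angles in general position. -/
theorem sin_cos_ne_zero
    (h : ∀ x : Fin 3 → ℂ, x ≠ 0 → ∀ j k : Fin 5, ∃ i, i ≠ j ∧ i ≠ k ∧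
      star (aliceKet θ γ φ i) ⬝ᵥ x ≠ 0) :
    (Real.sin θ ≠ 0 ∧ Real.cos θ ≠ 0) ∧ Real.sin γ ≠ 0 ∧ Real.cos γ ≠ 0 := by
  have h2 : (![0, 0, 1] : Fin 3 → ℂ) ≠ 0 := fun h => by simpa using congr_fun h 2
  have h1 : (![0, 1, 0] : Fin 3 → ℂ) ≠ 0 := fun h => by simpa using congr_fun h 1
  refine ⟨⟨fun h0 => ?_, fun h0 => ?_⟩, fun h0 => ?_, fun h0 => ?_⟩
  -- In each degenerate case a basis vector is orthogonal to three of the kets; the two indices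
  -- given to `h` are the remaining ones.
  · obtain ⟨i, hj, hk, hi⟩ := h _ h2 3 4
    clear h
    fin_cases i <;> simp_all [aliceKet, upbKetTheta, upbKetGamma, upbKetLast, dotProduct,
      Fin.sum_univ_three, -Complex.ofReal_sin, -Complex.ofReal_cos]
  · obtain ⟨i, hj, hk, hi⟩ := h _ h2 2 4
    clear h
    fin_cases i <;> simp_all [aliceKet, upbKetTheta, upbKetGamma, upbKetLast, dotProduct,
      Fin.sum_univ_three, -Complex.ofReal_sin, -Complex.ofReal_cos]
  · obtain ⟨i, hj, hk, hi⟩ := h _ h2 2 4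
    clear h
    fin_cases i <;> simp_all [aliceKet, upbKetTheta, upbKetGamma, upbKetLast, dotProduct,
      Fin.sum_univ_three, -Complex.ofReal_sin, -Complex.ofReal_cos]
  · obtain ⟨i, hj, hk, hi⟩ := h _ h1 1 4
    clear h
    fin_cases i <;> simp_all [aliceKet, upbKetTheta, upbKetGamma, upbKetLast, dotProduct,
      Fin.sum_univ_three, -Complex.ofReal_sin, -Complex.ofReal_cos]

theorem aliceKet_nonorthogonal (hθ : Real.sin θ ≠ 0 ∧ Real.cos θ ≠ 0)
    (hγ : Real.sin γ ≠ 0 ∧ Real.cos γ ≠ 0) (i : Fin 5) :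
    star (aliceKet θ γ φ i) ⬝ᵥ aliceKet θ γ φ (i + 2) ≠ 0 := by
  obtain ⟨hs, hc⟩ := hθ
  obtain ⟨hsγ, hcγ⟩ := hγ
  have hN := upbNorm_ne_zero (θ := θ) hcγ
  rw [← Complex.ofReal_ne_zero] at hs hc hsγ hcγ
  fin_cases i <;>
    simp [aliceKet, upbKetTheta, upbKetGamma, upbKetLast, dotProduct, Fin.sum_univ_three,
      -Complex.ofReal_sin, -Complex.ofReal_cos, ← Complex.exp_conj, hs, hc, hsγ, hcγ, hN]

theorem aliceKet_nonorthogonal' (hθ : Real.sin θ ≠ 0 ∧ Real.cos θ ≠ 0)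
    (hγ : Real.sin γ ≠ 0 ∧ Real.cos γ ≠ 0) (i : Fin 5) :
    star (aliceKet θ γ φ (i + 2)) ⬝ᵥ aliceKet θ γ φ i ≠ 0 := by
  rw [Matrix.star_dotProduct]
  simpa using aliceKet_nonorthogonal hθ hγ i

/-- The edges at kets 0 and 1 remove the off-diagonal entries one after another. For diagonal `A`,
the edges 2–3 and 3–4 are nonzero multiples of differences of diagonal entries. -/
theorem eq_smul_one_of_pentagon (hθ : Real.sin θ ≠ 0 ∧ Real.cos θ ≠ 0)
    (hγ : Real.sin γ ≠ 0 ∧ Real.cos γ ≠ 0) {A : Matrix (Fin 3) (Fin 3) ℂ}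
    (h : ∀ i, star (aliceKet θ γ φ i) ⬝ᵥ A *ᵥ aliceKet θ γ φ (i + 1) = 0)
    (h' : ∀ i, star (aliceKet θ γ φ (i + 1)) ⬝ᵥ A *ᵥ aliceKet θ γ φ i = 0) :
    A = A 2 2 • 1 := by
  obtain ⟨hs, hc⟩ := hθ
  obtain ⟨hsγ, hcγ⟩ := hγ
  have hN := upbNorm_ne_zero (θ := θ) hcγ
  rw [← Complex.ofReal_ne_zero] at hs hc hsγ hcγ
  have he' := star_exp_I_mul_exp_I φ
  have h01 := h 0
  have h10 := h' 0
  have h12 := h 1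
  have h21 := h' 1
  have h23 := h 2
  have h34 := h 3
  have h40 := h 4
  have h04 := h' 4
  simp [aliceKet, upbKetTheta, upbKetGamma, upbKetLast, dotProduct, Matrix.mulVec,
    Fin.sum_univ_three, -Complex.ofReal_sin, -Complex.ofReal_cos] at h01 h10
  simp [aliceKet, upbKetTheta, upbKetGamma, upbKetLast, dotProduct, Matrix.mulVec,
    Fin.sum_univ_three, -Complex.ofReal_sin, -Complex.ofReal_cos, h01, h10, hs, hcγ, hN]
    at h12 h21 h40 h04
  simp [aliceKet, upbKetTheta, upbKetGamma, upbKetLast, dotProduct, Matrix.mulVec,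
    Fin.sum_univ_three, -Complex.ofReal_sin, -Complex.ofReal_cos, h01, h10, h12, h21, h40, h04]
    at h23 h34
  have h00 : A 0 0 = A 2 2 := by
    have : (Real.cos θ * Real.sin γ * Real.sin θ : ℂ) * (A 0 0 - A 2 2) = 0 := by
      linear_combination h23
    exact sub_eq_zero.1 ((mul_eq_zero.1 this).resolve_left (mul_ne_zero (mul_ne_zero hc hsγ) hs))
  have h11 : A 1 1 = A 2 2 := by
    have : (Real.cos γ * Real.sin γ * Real.cos θ * (upbNorm θ γ : ℂ)⁻¹) * (A 1 1 - A 2 2) = 0 := by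
      linear_combination h34 - (Real.cos γ * Real.sin γ * Real.cos θ * (upbNorm θ γ : ℂ)⁻¹) *
        A 1 1 * he'
    exact sub_eq_zero.1 ((mul_eq_zero.1 this).resolve_left
      (mul_ne_zero (mul_ne_zero (mul_ne_zero hcγ hsγ) hc) (inv_ne_zero hN)))
  ext i j
  fin_cases i <;> fin_cases j <;> simp [h01, h10, h12, h21, h40, h04, h00, h11]

end Pentagon

/-! ### Product kets and unextendibility. -/

section ProductKets

theorem star_productKet_dotProduct {dA dB : ℕ} (a x : Fin dA → ℂ) (b y : Fin dB → ℂ) :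
    star (productKet a b) ⬝ᵥ productKet x y = (star a ⬝ᵥ x) * (star b ⬝ᵥ y) := by
  simp only [dotProduct, Fintype.sum_prod_type, Finset.sum_mul_sum, productKet, Pi.star_apply,
    star_mul']
  exact Finset.sum_congr rfl fun _ _ => Finset.sum_congr rfl fun _ _ => by ring

theorem kronecker_mulVec_productKet {dA dB : ℕ} (A : Matrix (Fin dA) (Fin dA) ℂ)
    (B : Matrix (Fin dB) (Fin dB) ℂ) (x : Fin dA → ℂ) (y : Fin dB → ℂ) :
    (A ⊗ₖ B) *ᵥ productKet x y = productKet (A *ᵥ x) (B *ᵥ y) := by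
  ext p
  simp only [Matrix.mulVec, dotProduct, Fintype.sum_prod_type, Finset.sum_mul_sum, productKet,
    Matrix.kroneckerMap_apply]
  exact Finset.sum_congr rfl fun _ _ => Finset.sum_congr rfl fun _ _ => by ring

theorem productKet_ne_zero {dA dB : ℕ} {a : Fin dA → ℂ} {b : Fin dB → ℂ} (ha : a ≠ 0)
    (hb : b ≠ 0) : productKet a b ≠ 0 := by
  obtain ⟨i, hi⟩ := Function.ne_iff.1 ha
  obtain ⟨j, hj⟩ := Function.ne_iff.1 hb
  exact Function.ne_iff.2 ⟨(i, j), mul_ne_zero hi hj⟩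

theorem exists_ne_zero_orthogonal (y z : Fin 3 → ℂ) :
    ∃ x : Fin 3 → ℂ, x ≠ 0 ∧ star y ⬝ᵥ x = 0 ∧ star z ⬝ᵥ x = 0 := by
  obtain ⟨x, hx, h⟩ := Matrix.exists_mulVec_eq_zero_iff.2
    (Matrix.det_eq_zero_of_row_eq_zero (A := Matrix.of ![star y, star z, 0]) 2 fun _ => rfl)
  exact ⟨x, hx, congr_fun h 0, congr_fun h 1⟩

/-- Two vectors of `ℂ³` have a common nonzero orthogonal vector. If `x` handled all labels except
`j` and `k` on the left, such a vector on the right would handle these two and extend the basis. -/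
theorem IsUPB.exists_not_orthogonal_left {ι : Type} [DecidableEq ι] {dA : ℕ}
    {a : ι → Fin dA → ℂ} {b : ι → Fin 3 → ℂ} (h : IsUPB fun i => productKet (a i) (b i))
    {x : Fin dA → ℂ} (hx : x ≠ 0) (j k : ι) : ∃ i, i ≠ j ∧ i ≠ k ∧ star (a i) ⬝ᵥ x ≠ 0 := by
  by_contra! hc
  obtain ⟨y, hy, hj, hk⟩ := exists_ne_zero_orthogonal (b j) (b k)
  refine productKet_ne_zero hx hy (h.unextendible x y fun i => ?_)
  rw [star_productKet_dotProduct]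
  by_cases hij : i = j
  · rw [hij, hj, mul_zero]
  by_cases hik : i = k
  · rw [hik, hk, mul_zero]
  rw [hc i hij hik, zero_mul]

theorem IsUPB.exists_not_orthogonal_right {ι : Type} [DecidableEq ι] {dB : ℕ}
    {a : ι → Fin 3 → ℂ} {b : ι → Fin dB → ℂ} (h : IsUPB fun i => productKet (a i) (b i))
    {y : Fin dB → ℂ} (hy : y ≠ 0) (j k : ι) : ∃ i, i ≠ j ∧ i ≠ k ∧ star (b i) ⬝ᵥ y ≠ 0 := by
  by_contra! hc
  obtain ⟨x, hx, hj, hk⟩ := exists_ne_zero_orthogonal (a j) (a k)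
  refine productKet_ne_zero hx hy (h.unextendible x y fun i => ?_)
  rw [star_productKet_dotProduct]
  by_cases hij : i = j
  · rw [hij, hj, zero_mul]
  by_cases hik : i = k
  · rw [hik, hk, zero_mul]
  rw [hc i hij hik, mul_zero]

theorem star_mulVec_dotProduct_mulVec_mulVec {n : Type*} [Fintype n] (U A : Matrix n n ℂ)
    (x y : n → ℂ) : star (U *ᵥ x) ⬝ᵥ A *ᵥ (U *ᵥ y) = star x ⬝ᵥ (Uᴴ * A * U) *ᵥ y := by
  rw [Matrix.star_mulVec, ← Matrix.dotProduct_mulVec, Matrix.mulVec_mulVec, Matrix.mulVec_mulVec,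
    Matrix.mul_assoc]

end ProductKets

/-! ### Isolation of the identity for the given family. -/

section Main
open scoped Topology

theorem unitary_conjTranspose_mul (U : Matrix.unitaryGroup (Fin 3) ℂ) :
    (U : Matrix (Fin 3) (Fin 3) ℂ)ᴴ * U = 1 := Matrix.UnitaryGroup.star_mul_self U

theorem unitary_mul_conjTranspose (U : Matrix.unitaryGroup (Fin 3) ℂ) :
    (U : Matrix (Fin 3) (Fin 3) ℂ) * (U : Matrix (Fin 3) (Fin 3) ℂ)ᴴ = 1 :=
  mul_eq_one_comm.1 (unitary_conjTranspose_mul U)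

theorem star_unitary_mulVec_dotProduct (U : Matrix.unitaryGroup (Fin 3) ℂ) (x y : Fin 3 → ℂ) :
    star ((U : Matrix (Fin 3) (Fin 3) ℂ) *ᵥ x) ⬝ᵥ ((U : Matrix (Fin 3) (Fin 3) ℂ) *ᵥ y) =
      star x ⬝ᵥ y := by
  have := star_mulVec_dotProduct_mulVec_mulVec (U : Matrix (Fin 3) (Fin 3) ℂ) 1 x y
  rwa [Matrix.one_mulVec, Matrix.mul_one, unitary_conjTranspose_mul, Matrix.one_mulVec] at this

theorem unitary_mulVec_ne_zero (U : Matrix.unitaryGroup (Fin 3) ℂ) {x : Fin 3 → ℂ} (hx : x ≠ 0) :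
    (U : Matrix (Fin 3) (Fin 3) ℂ) *ᵥ x ≠ 0 := fun h => hx <| by
  have := congr_arg (fun y => (U : Matrix (Fin 3) (Fin 3) ℂ)ᴴ *ᵥ y) h
  simpa [Matrix.mulVec_mulVec, unitary_conjTranspose_mul] using this

/-- Sesquilinear forms near the identity keep non-orthogonal vectors non-orthogonal. -/
theorem eventually_form_ne_zero (a : Fin 5 → Fin 3 → ℂ) :
    ∀ᶠ A : Matrix (Fin 3) (Fin 3) ℂ in 𝓝 (((3 : ℕ) : ℂ)⁻¹ • 1), ∀ i j,
      star (a i) ⬝ᵥ a j ≠ 0 → star (a i) ⬝ᵥ A *ᵥ a j ≠ 0 := by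
  refine Filter.eventually_all.2 fun i => Filter.eventually_all.2 fun j => ?_
  by_cases h : star (a i) ⬝ᵥ a j = 0
  · exact Filter.Eventually.of_forall fun A h' => (h' h).elim
  have hcont : Continuous fun A : Matrix (Fin 3) (Fin 3) ℂ => star (a i) ⬝ᵥ A *ᵥ a j :=
    continuous_const.dotProduct (continuous_id.matrix_mulVec continuous_const)
  filter_upwards [hcont.continuousAt.eventually_ne (y := 0) (by
    simpa only [Matrix.smul_mulVec, Matrix.one_mulVec, dotProduct_smul, smul_eq_mul, mul_eq_zero,
      inv_eq_zero, Nat.cast_eq_zero, OfNat.ofNat_ne_zero, false_or, ne_eq] using h)]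
    with A hA _ using hA

theorem eq_inv_smul_one_of_pentagon {θ γ φ : ℝ} (hθ : Real.sin θ ≠ 0 ∧ Real.cos θ ≠ 0)
    (hγ : Real.sin γ ≠ 0 ∧ Real.cos γ ≠ 0) (U : Matrix.unitaryGroup (Fin 3) ℂ)
    {A : Matrix (Fin 3) (Fin 3) ℂ} (htr : A.trace = 1)
    (h : ∀ i, star ((U : Matrix (Fin 3) (Fin 3) ℂ) *ᵥ aliceKet θ γ φ i) ⬝ᵥ
      A *ᵥ ((U : Matrix (Fin 3) (Fin 3) ℂ) *ᵥ aliceKet θ γ φ (i + 1)) = 0)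
    (h' : ∀ i, star ((U : Matrix (Fin 3) (Fin 3) ℂ) *ᵥ aliceKet θ γ φ (i + 1)) ⬝ᵥ
      A *ᵥ ((U : Matrix (Fin 3) (Fin 3) ℂ) *ᵥ aliceKet θ γ φ i) = 0) :
    A = ((3 : ℕ) : ℂ)⁻¹ • 1 := by
  simp only [star_mulVec_dotProduct_mulVec_mulVec] at h h'
  have key := eq_smul_one_of_pentagon hθ hγ h h'
  generalize ((U : Matrix (Fin 3) (Fin 3) ℂ)ᴴ * A * U) 2 2 = a at key
  have hA : A = a • 1 := by
    calc A = U * ((U : Matrix (Fin 3) (Fin 3) ℂ)ᴴ * A * U) * (U : Matrix (Fin 3) (Fin 3) ℂ)ᴴ := by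
          simp only [Matrix.mul_assoc, unitary_mul_conjTranspose, Matrix.mul_one]
          rw [← Matrix.mul_assoc, unitary_mul_conjTranspose, Matrix.one_mul]
      _ = a • 1 := by rw [key]; simp [unitary_mul_conjTranspose]
  rw [hA] at htr ⊢
  congr 1
  simp at htr
  simpa using eq_inv_of_mul_eq_one_left htr

theorem mainTheorem3
    (θA γA φA θB γB φB : ℝ)
    (U V : Matrix.unitaryGroup (Fin 3) ℂ)
    (ψ : Fin 5 → Fin 3 × Fin 3 → ℂ)
    (hψ : ∀ i, ψ i = productKet ((U : Matrix (Fin 3) (Fin 3) ℂ) *ᵥ aliceKet θA γA φA i)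
      ((V : Matrix (Fin 3) (Fin 3) ℂ) *ᵥ bobKet θB γB φB i))
    (hUPB : IsUPB ψ) :
    ¬ DiscriminableByAsymptoticLOCC (fun i => pureState (ψ i)) := by
  obtain rfl : ψ = fun i => _ := funext hψ
  obtain ⟨hθA, hγA⟩ := sin_cos_ne_zero (θ := θA) (γ := γA) (φ := φA) fun x hx j k => by
    obtain ⟨i, hj, hk, hi⟩ :=
      hUPB.exists_not_orthogonal_left (unitary_mulVec_ne_zero U hx) j k
    exact ⟨i, hj, hk, by rwa [star_unitary_mulVec_dotProduct] at hi⟩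
  obtain ⟨hθB, hγB⟩ := sin_cos_ne_zero (θ := θB) (γ := γB) (φ := φB) fun x hx j k => by
    obtain ⟨i, hj, hk, hi⟩ := hUPB.exists_not_orthogonal_right (unitary_mulVec_ne_zero V hx)
      -- Modulo 5, `3 * j + 2` is the preimage of `j` under Bob's relabelling `i ↦ 2 * i + 1`.
      (3 * j + 2) (3 * k + 2)
    rw [star_unitary_mulVec_dotProduct, bobKet_apply] at hi
    have hne : ∀ i j : Fin 5, i ≠ 3 * j + 2 → 2 * i + 1 ≠ j := by decide
    exact ⟨2 * i + 1, hne i j hj, hne i k hk, hi⟩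
  refine not_discriminableByAsymptoticLOCC (fun i => by simpa using hUPB.orthonormal i i) ?_
  rw [nhds_prod_eq]
  filter_upwards [(eventually_form_ne_zero
      fun i => (U : Matrix (Fin 3) (Fin 3) ℂ) *ᵥ aliceKet θA γA φA i).prod_mk
    (eventually_form_ne_zero fun i => (V : Matrix (Fin 3) (Fin 3) ℂ) *ᵥ bobKet θB γB φB i)]
    with p ⟨hA, hB⟩ htA htB hort
  simp only [kronecker_mulVec_productKet, star_productKet_dotProduct, mul_eq_zero] at hort
  simp only [star_unitary_mulVec_dotProduct] at hA hB
  have hA' : ∀ i, star (aliceKet θA γA φA i) ⬝ᵥ aliceKet θA γA φA (i + 3) ≠ 0 := fun i => by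
    simpa only [add_assoc, show (3 : Fin 5) + 2 = 0 from rfl, add_zero] using
      aliceKet_nonorthogonal' (φ := φA) hθA hγA (i + 3)
  have hA'' : ∀ i, star (aliceKet θA γA φA (i + 3)) ⬝ᵥ aliceKet θA γA φA i ≠ 0 := fun i => by
    simpa only [add_assoc, show (3 : Fin 5) + 2 = 0 from rfl, add_zero] using
      aliceKet_nonorthogonal (φ := φA) hθA hγA (i + 3)
  have hne : ∀ i : Fin 5, i ≠ i + 1 ∧ i ≠ i + 3 := by decide
  have hbob : ∀ k, aliceKet θB γB φB k = bobKet θB γB φB (3 * k + 2) := fun k => by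
    rw [bobKet_apply]
    exact congr_arg _ ((by decide : ∀ k : Fin 5, k = 2 * (3 * k + 2) + 1) k)
  have hstep : ∀ k : Fin 5, 3 * (k + 1) + 2 = 3 * k + 2 + 3 := by decide
  have hstep' : ∀ k : Fin 5, 2 * (k + 1) + 1 = 2 * k + 1 + 2 := by decide
  refine Prod.ext (eq_inv_smul_one_of_pentagon (φ := φA) hθA hγA U htA (fun i => ?_) fun i => ?_)
    (eq_inv_smul_one_of_pentagon (φ := φB) hθB hγB V htB (fun i => ?_) fun i => ?_)
  -- Neighbouring labels are nonorthogonal for Bob, so the vanishing factor is Alice's.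
  · refine (hort i (i + 1) (hne i).1).resolve_right (hB _ _ ?_)
    rw [bobKet_apply, bobKet_apply, hstep']
    exact aliceKet_nonorthogonal hθB hγB _
  · refine (hort (i + 1) i (hne i).1.symm).resolve_right (hB _ _ ?_)
    rw [bobKet_apply, bobKet_apply, hstep']
    exact aliceKet_nonorthogonal' hθB hγB _
  -- Neighbours in Bob's pentagon have labels three apart, where Alice's kets are nonorthogonal.
  · rw [hbob, hbob, hstep]
    exact (hort _ _ (hne _).2).resolve_left (hA _ _ (hA' _))
  · rw [hbob, hbob, hstep]
    exact (hort _ _ (hne _).2.symm).resolve_left (hA _ _ (hA'' _))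

end Main
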